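/- Let $R$ be an associative ring with identity that is von Neumann regular (for every $a\in R$ there is $x\in R$ with $axa=a$). A right $R$-module $M$ is called a $V$-module if every proper submodule of $M$ is an intersection of maximal submodules of $M$, and $R$ is called a right $V$-ring if $R_R$ is a $V$-module. A right $R$-module $M$ is called almost injective if for every right $R$-module $N$, every submodule $N'$ of $N$ with inclusion $\iota:N'\to N$, and every homomorphism $f:N'\to M$, either there is a homomorphism $g:N\to M$ with $g\iota=f$, or there are a nonzero idempotent $\pi\in\operatorname{End}_R(N)$ and a homomorphism $h:M\to\pi(N)$ with $hf=\pi\iota$. The ring $R$ is called a right almost $V$-ring if every simple right $R$-module is almost injective. Then the following assertions are equivalent: 1) $R$ is a right $V$-ring. 2) Every right $R$-module is a direct sum of an injective module and a $V$-module. 3) Every right $R$-module is a direct sum of a projective module and a $V$-module. 4) $R$ is a right almost $V$-ring. -/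

import Mathlib

universe u

/-- A ring is (von Neumann) regular if every element `a` has a quasi-inverse `x`: `a x a = a`. -/
def IsVNRegularRing (R : Type u) [Ring R] : Prop :=
  ∀ a : R, ∃ x : R, a * x * a = a

/-- A module is a `V`-module (cosemisimple) if every proper submodule is an intersection of
maximal submodules. -/
def IsVModule (A : Type u) [Ring A] (M : Type u) [AddCommGroup M] [Module A M] : Prop :=
  ∀ N : Submodule A M, N ≠ ⊤ →
    ∃ S : Set (Submodule A M), (∀ L ∈ S, IsCoatom L) ∧ N = sInf S

/-- `M` is almost `N`-injective: every homomorphism `f : N' → M` from a submodule `N'` of `N`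
either extends to `N`, or there are a nonzero idempotent endomorphism `π` of `N` and a homomorphism
`h : M → π(N)` such that `h ∘ f` is the restriction of `π` to `N'`. -/
def IsAlmostInjectiveRel (A : Type u) [Ring A] (M N : Type u) [AddCommGroup M] [Module A M]
    [AddCommGroup N] [Module A N] : Prop :=
  ∀ (N' : Submodule A N) (f : N' →ₗ[A] M),
    (∃ g : N →ₗ[A] M, g ∘ₗ N'.subtype = f) ∨
    ∃ π : Module.End A N, π ≠ 0 ∧ IsIdempotentElem π ∧
      ∃ h : M →ₗ[A] LinearMap.range π,
        (LinearMap.range π).subtype ∘ₗ h ∘ₗ f = π ∘ₗ N'.subtype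

/-- `M` is almost injective if it is almost `N`-injective for every module `N`. -/
def IsAlmostInjective (A : Type u) [Ring A] (M : Type u) [AddCommGroup M] [Module A M] : Prop :=
  ∀ (N : Type u) [AddCommGroup N] [Module A N], IsAlmostInjectiveRel A M N

/-! Right `R`-modules are modules over the opposite ring `Rᵐᵒᵖ`. -/

/-- `R` is a right `V`-ring if the right module `R_R` is a `V`-module. -/
def IsRightVRing (R : Type u) [Ring R] : Prop :=
  IsVModule Rᵐᵒᵖ R

/-- `R` is a right almost `V`-ring if every simple right `R`-module is almost injective. -/
def IsRightAlmostVRing (R : Type u) [Ring R] : Prop :=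
  ∀ (S : Type u) [AddCommGroup S] [Module Rᵐᵒᵖ S],
    IsSimpleModule Rᵐᵒᵖ S → IsAlmostInjective Rᵐᵒᵖ S

/-! Suppose the ring A is not a V-ring. Dividing A by a left ideal maximal among those avoiding a
suitable element gives a cyclic non-simple module E = Ax whose nonzero submodules all contain some s
≠ 0 (`exists_isCyclicMonolith`). A map E → As fixing s cannot exist: it would be injective, making E
simple (`not_retract`). Regularity turns each of conditions 2, 3 and 4 into such a map. For 2 and 3,
a V-module summand meets the radical in 0, while s lies in the radical of E; so the V-summand of E,
or of a direct sum of copies of E, vanishes, leaving an injective or projective module. Conversely,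
over a V-ring simple modules are injective and all modules are V-modules, so trivial decompositions
suffice. -/

section Ring

variable {A : Type u} [Ring A]

/-- In a regular ring, an idempotent `g` and an element `r` of a left ideal `J` are both fixed by
right multiplication by some idempotent of `J`. -/
theorem IsVNRegularRing.exists_idempotent_mem (hA : IsVNRegularRing A) (J : Ideal A) {g r : A}
    (hg : IsIdempotentElem g) (hgJ : g ∈ J) (hrJ : r ∈ J) :
    ∃ g' ∈ J, IsIdempotentElem g' ∧ g * g' = g ∧ r * g' = r := by
  obtain ⟨x, hx⟩ := hA (r - r * g)
  obtain ⟨q, hq⟩ : ∃ q, q = r - r * g := ⟨_, rfl⟩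
  rw [← hq] at hx
  have hgg : g * g = g := hg
  have hqg : q * g = 0 := by rw [hq, sub_mul, mul_assoc, hgg, sub_self]
  have hqJ : q ∈ J := hq ▸ J.sub_mem hrJ (J.mul_mem_left r hgJ)
  -- Since qg = 0, the element (1 - g)xq is an idempotent orthogonal to g; adding it to g gives the
  -- witness.
  have hgf : g * (g + x * q - g * (x * q)) = g := by
    rw [mul_sub, mul_add, hgg, ← mul_assoc g g, hgg, add_sub_cancel_right]
  have hqf : q * (g + x * q - g * (x * q)) = q := by
    rw [mul_sub, mul_add, hqg, ← mul_assoc q g, hqg, ← mul_assoc, hx]; simp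
  refine ⟨g + x * q - g * (x * q), ?_, ?_, hgf, ?_⟩
  · exact J.sub_mem (J.add_mem hgJ (J.mul_mem_left x hqJ))
      (J.mul_mem_left g (J.mul_mem_left x hqJ))
  · unfold IsIdempotentElem
    conv_lhs => rw [sub_mul, add_mul, hgf, mul_assoc x q, hqf, mul_assoc g, mul_assoc x q, hqf]
  · have hr : r = q + r * g := by rw [hq]; abel
    conv_lhs => rw [hr, add_mul, hqf, mul_assoc, hgf]
    exact hr.symm

theorem IsVNRegularRing.mulOpposite (hA : IsVNRegularRing A) : IsVNRegularRing Aᵐᵒᵖ := by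
  intro a
  obtain ⟨x, hx⟩ := hA a.unop
  refine ⟨MulOpposite.op x, MulOpposite.unop_injective ?_⟩
  simpa [mul_assoc] using hx

end Ring

/-! ### V-modules and the radical -/

section VModule

variable {A : Type u} [Ring A] {M : Type u} [AddCommGroup M] [Module A M]

/-- Any submodule avoiding `y` is contained in one that is maximal with this property. -/
theorem Submodule.exists_le_maximal_notMem {N : Submodule A M} {y : M} (hy : y ∉ N) :
    ∃ L, N ≤ L ∧ y ∉ L ∧ ∀ L', L < L' → y ∈ L' := by
  obtain ⟨L, hNL, hL⟩ := zorn_le_nonempty₀ {L : Submodule A M | y ∉ L}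
    (fun c hc hchain z hz => ⟨sSup c, by
      simp only [Set.mem_ofPred_eq, Submodule.mem_sSup_of_directed ⟨z, hz⟩ hchain.directedOn]
      rintro ⟨w, hw, hyw⟩
      exact hc hw hyw, fun z hz => le_sSup hz⟩) N hy
  exact ⟨L, hNL, hL.prop, fun L' h => by_contra fun h' => (hL.not_prop_of_gt h) h'⟩

theorem isVModule_iff_exists_isCoatom : IsVModule A M ↔
    ∀ (N : Submodule A M) (y : M), y ∉ N → ∃ K, IsCoatom K ∧ N ≤ K ∧ y ∉ K := by
  constructor
  · intro h N y hy
    obtain ⟨S, hS, rfl⟩ := h N (by rintro rfl; exact hy trivial)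
    simp only [Submodule.mem_sInf, not_forall] at hy
    obtain ⟨K, hK, hyK⟩ := hy
    exact ⟨K, hS K hK, sInf_le hK, hyK⟩
  · intro h N _
    refine ⟨{K | IsCoatom K ∧ N ≤ K}, fun L hL => hL.1,
      le_antisymm (le_sInf fun K hK => hK.2) fun y hy => ?_⟩
    by_contra hyN
    obtain ⟨K, hK, hNK, hyK⟩ := h N y hyN
    exact hyK (Submodule.mem_sInf.mp hy K ⟨hK, hNK⟩)

theorem IsVModule.of_linearEquiv {M' : Type u} [AddCommGroup M'] [Module A M'] (e : M ≃ₗ[A] M')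
    (h : IsVModule A M) : IsVModule A M' := by
  rw [isVModule_iff_exists_isCoatom] at h ⊢
  intro N y hy
  obtain ⟨K, hK, hNK, hyK⟩ := h (N.comap e.toLinearMap) (e.symm y) (by simpa using hy)
  refine ⟨K.map e.toLinearMap, ?_, ?_, ?_⟩
  · exact ((Submodule.orderIsoMapComap e).isCoatom_iff K).mpr hK
  · intro z hz
    exact ⟨e.symm z, hNK (by simpa using hz), by simp⟩
  · rintro ⟨k, hk, rfl⟩
    exact hyK (by simpa using hk)

theorem IsVModule.jacobson_eq_bot (h : IsVModule A M) : Module.jacobson A M = ⊥ := by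
  rw [isVModule_iff_exists_isCoatom] at h
  rw [eq_bot_iff]
  intro y hy
  by_contra hy0
  obtain ⟨K, hK, -, hyK⟩ := h ⊥ y hy0
  exact hyK (Submodule.mem_sInf.mp hy K hK)

/-- A direct summand that is a `V`-module meets the radical trivially. -/
theorem IsVModule.disjoint_jacobson {P Q : Submodule A M} (h : IsVModule A Q) (hPQ : IsCompl P Q) :
    Disjoint Q (Module.jacobson A M) := by
  rw [Submodule.disjoint_def]
  intro q hq hqJ
  have hmem := Module.le_comap_jacobson (Q.projectionOnto P hPQ.symm) hqJ
  rw [h.jacobson_eq_bot, Submodule.mem_comap, Submodule.mem_bot] at hmem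
  have := Submodule.projectionOnto_apply_left hPQ.symm ⟨q, hq⟩
  rw [hmem] at this
  exact congrArg Subtype.val this.symm

end VModule

/-! ### Cyclic non-simple modules with a least nonzero submodule -/

/-- `E` is generated by `x`, the nonzero element `s` lies in every nonzero submodule of `E`, and
`E` is not simple. -/
structure IsCyclicMonolith (A : Type u) [Ring A] {E : Type u} [AddCommGroup E] [Module A E]
    (x s : E) : Prop where
  generates : ∀ y : E, ∃ r : A, r • x = y
  ne_zero : s ≠ 0
  mem : ∀ T : Submodule A E, T ≠ ⊥ → s ∈ T
  not_simple : ¬ IsSimpleModule A E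

theorem exists_isCyclicMonolith {A : Type u} [Ring A] (h : ¬ IsVModule A A) :
    ∃ L : Ideal A, ∃ x s : A ⧸ L, IsCyclicMonolith A x s := by
  rw [isVModule_iff_exists_isCoatom] at h
  push Not at h
  obtain ⟨N, y, hy, hN⟩ := h
  obtain ⟨L, hNL, hyL, hL⟩ := Submodule.exists_le_maximal_notMem hy
  refine ⟨L, L.mkQ 1, L.mkQ y, ?_, ?_, ?_, ?_⟩
  · intro z
    obtain ⟨r, rfl⟩ := L.mkQ_surjective z
    exact ⟨r, by rw [← map_smul, smul_eq_mul, mul_one]⟩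
  · simpa using hyL
  · intro T hT
    refine hL (T.comap L.mkQ) (lt_of_le_of_ne (Submodule.le_comap_mkQ L T) fun hLT => hT ?_)
    rw [← Submodule.map_comap_eq_of_surjective L.mkQ_surjective T, ← hLT, Submodule.mkQ_map_self]
  · intro hs
    exact hyL (hN L (isSimpleModule_iff_isCoatom.mp hs) hNL)

namespace IsCyclicMonolith

variable {A : Type u} [Ring A] {E : Type u} [AddCommGroup E] [Module A E] {x s : E}

theorem exists_smul_eq (h : IsCyclicMonolith A x s) {y : E} (hy : y ≠ 0) : ∃ a : A, a • y = s :=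
  Submodule.mem_span_singleton.mp (h.mem (A ∙ y) (by simpa using hy))

theorem injective_of_apply_ne_zero (h : IsCyclicMonolith A x s) {M : Type*} [AddCommGroup M]
    [Module A M] (g : E →ₗ[A] M) (hg : g s ≠ 0) : Function.Injective g := by
  rw [← LinearMap.ker_eq_bot]
  by_contra hk
  exact hg (h.mem _ hk)

theorem isSimpleModule_of_surjective (h : IsCyclicMonolith A x s)
    (hs : ∀ y : E, ∃ a : A, a • s = y) : IsSimpleModule A E := by
  have : Nontrivial E := ⟨s, 0, h.ne_zero⟩
  refine isSimpleModule_iff_toSpanSingleton_surjective.mpr ⟨this, fun y hy z => ?_⟩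
  obtain ⟨a, ha⟩ := h.exists_smul_eq hy
  obtain ⟨b, hb⟩ := hs z
  exact ⟨b * a, by simp [mul_smul, ha, hb]⟩

/-- The submodule generated by `s` is not a direct summand. -/
theorem not_retract (h : IsCyclicMonolith A x s) (g : E →ₗ[A] E)
    (hg : ∀ y, g y ∈ A ∙ s) (hgs : g s = s) : False := by
  have hinj := h.injective_of_apply_ne_zero g (by rw [hgs]; exact h.ne_zero)
  refine h.not_simple (h.isSimpleModule_of_surjective fun y => ?_)
  obtain ⟨a, ha⟩ := Submodule.mem_span_singleton.mp (hg y)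
  exact ⟨a, hinj (by rw [map_smul, hgs, ha])⟩

/-- A linear map on `E` may be prescribed on the generator, subject to its relations. -/
theorem exists_linearMap (h : IsCyclicMonolith A x s) {z : E}
    (hz : ∀ r : A, r • x = 0 → r • z = 0) : ∃ g : E →ₗ[A] E, ∀ r : A, g (r • x) = r • z := by
  let ρ := LinearMap.toSpanSingleton A E x
  have hρ : Function.Surjective ρ := fun y => h.generates y
  refine ⟨(LinearMap.ker ρ).liftQ (LinearMap.toSpanSingleton A E z) (fun r hr => ?_) ∘ₗ
    (ρ.quotKerEquivOfSurjective hρ).symm.toLinearMap, fun r => ?_⟩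
  · simpa using hz r (by simpa [ρ] using hr)
  · have : (ρ.quotKerEquivOfSurjective hρ).symm (r • x) = (LinearMap.ker ρ).mkQ r := by
      rw [LinearEquiv.symm_apply_eq]
      rfl
    rw [LinearMap.comp_apply, LinearEquiv.coe_coe, this]
    simp

theorem isSimpleModule_span (h : IsCyclicMonolith A x s) :
    IsSimpleModule A (A ∙ s) := by
  rw [isSimpleModule_iff_isAtom]
  refine ⟨by simpa using h.ne_zero, fun T hT => by_contra fun hT0 => ?_⟩
  exact hT.not_ge ((Submodule.span_singleton_le_iff_mem _ _).mpr (h.mem T hT0))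

theorem mem_jacobson (h : IsCyclicMonolith A x s) : s ∈ Module.jacobson A E := by
  refine Submodule.mem_sInf.mpr fun K hK => h.mem K ?_
  rintro rfl
  refine h.not_simple ?_
  have := isSimpleModule_iff_isCoatom.mpr hK
  exact IsSimpleModule.congr (Submodule.quotEquivOfEqBot (⊥ : Submodule A E) rfl).symm

/-- A scalar carrying one bad coordinate to s keeps the good ones in As, so the number of bad
coordinates drops. -/
theorem exists_smul_finsupp_mem (h : IsCyclicMonolith A x s) {ι : Type*} (n : ℕ) :
    ∀ m : ι →₀ E, m ≠ 0 → {i | m i ∉ A ∙ s}.ncard ≤ n →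
      ∃ a : A, a • m ≠ 0 ∧ ∀ i, (a • m) i ∈ A ∙ s := by
  classical
  have hfin : ∀ m : ι →₀ E, {i | m i ∉ A ∙ s}.Finite := fun m =>
    m.support.finite_toSet.subset fun i hi => by
      simp only [Finset.mem_coe, Finsupp.mem_support_iff]
      intro h0
      exact hi (h0 ▸ zero_mem _)
  induction n with
  | zero =>
    intro m hm hc
    have hemp := (Set.ncard_eq_zero (hfin m)).mp (Nat.le_zero.mp hc)
    refine ⟨1, by simpa using hm, fun i => ?_⟩
    by_contra hi
    rw [one_smul] at hi
    exact (Set.ext_iff.mp hemp i).mp hi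
  | succ n ih =>
    intro m hm hc
    by_cases hall : ∀ i, m i ∈ A ∙ s
    · exact ⟨1, by simpa using hm, by simpa using hall⟩
    push Not at hall
    obtain ⟨k, hk⟩ := hall
    obtain ⟨a, ha⟩ := h.exists_smul_eq (y := m k) (fun h0 => hk (h0 ▸ zero_mem _))
    have ham : a • m ≠ 0 := fun h0 => h.ne_zero (by
      rw [← ha, ← Finsupp.smul_apply, h0, Finsupp.zero_apply])
    have hlt : {i | (a • m) i ∉ A ∙ s}.ncard < {i | m i ∉ A ∙ s}.ncard := by
      refine Set.ncard_lt_ncard ⟨fun i hi hmi => hi (Submodule.smul_mem _ a hmi), fun hsub => ?_⟩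
        (hfin m)
      refine hsub hk ?_
      rw [Finsupp.smul_apply, ha]
      exact Submodule.mem_span_singleton_self s
    obtain ⟨b, hb, hb'⟩ := ih (a • m) ham (by omega)
    exact ⟨b * a, by rwa [mul_smul], by simpa only [mul_smul] using hb'⟩

/-- The radical of a direct sum of copies of `E` is essential. -/
theorem eq_bot_of_disjoint_jacobson (h : IsCyclicMonolith A x s) {ι : Type*}
    {Q : Submodule A (ι →₀ E)} (hQ : Disjoint Q (Module.jacobson A (ι →₀ E))) : Q = ⊥ := by
  rw [Submodule.eq_bot_iff]
  intro q hq
  by_contra hq0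
  obtain ⟨a, ha, hmem⟩ := h.exists_smul_finsupp_mem _ q hq0 le_rfl
  refine ha (Submodule.disjoint_def.mp hQ _ (Q.smul_mem a hq) ?_)
  rw [← Finsupp.sum_single (a • q)]
  refine Submodule.sum_mem _ fun i _ => ?_
  refine Module.le_comap_jacobson (Finsupp.lsingle (R := A) (M := E) i) ?_
  exact (Submodule.span_singleton_le_iff_mem _ _).mpr h.mem_jacobson (hmem i)

end IsCyclicMonolith

/-- Over a regular ring, if a countable direct sum of copies of `E` is injective, then modulo the
annihilator of `E` every left ideal is generated by an idempotent. -/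
theorem exists_idempotent_generator_mod_annihilator {A : Type u} [Ring A] (hA : IsVNRegularRing A)
    {E : Type u} [AddCommGroup E] [Module A E] (hE : Module.Injective A (ℕ →₀ E)) (J : Ideal A) :
    ∃ g ∈ J, ∀ r ∈ J, ∀ y : E, r • y = r • g • y := by
  by_contra! hcon
  have hstep : ∀ p : {g : A // g ∈ J ∧ IsIdempotentElem g},
      ∃ p' : {g : A // g ∈ J ∧ IsIdempotentElem g}, p.1 * p'.1 = p.1 ∧
        ∃ y : E, p.1 • y = 0 ∧ p'.1 • y ≠ 0 := by
    rintro ⟨g, hgJ, hg⟩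
    obtain ⟨r, hrJ, y, hy⟩ := hcon g hgJ
    obtain ⟨g', hg'J, hg', hgg', hrg'⟩ := hA.exists_idempotent_mem J hg hgJ hrJ
    refine ⟨⟨g', hg'J, hg'⟩, hgg', y - g • y, ?_, fun h0 => hy ?_⟩
    · rw [smul_sub, ← mul_smul, hg.eq, sub_self]
    · have := congrArg (r • ·) h0
      simp only [← mul_smul, smul_zero, hrg', smul_sub, sub_eq_zero] at this
      rwa [← mul_assoc, hrg', mul_smul] at this
  choose next hnext y hy hy' using hstep
  let p : ℕ → {g : A // g ∈ J ∧ IsIdempotentElem g} := fun n =>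
    Nat.rec ⟨0, J.zero_mem, IsIdempotentElem.zero⟩ (fun _ => next) n
  have hpsucc : ∀ n, p (n + 1) = next (p n) := fun n => rfl
  have hmono : ∀ m n, m ≤ n → (p m).1 * (p n).1 = (p m).1 := by
    intro m n hmn
    induction n, hmn using Nat.le_induction with
    | base => exact (p m).2.2
    | succ n _ ih =>
      conv_lhs => rw [← ih, mul_assoc, hpsucc, hnext]
      exact ih
  -- I is the union of the increasing left ideals A(p n). Each r in I kills almost all y (p n), so r
  -- ↦ (r • y (p n))ₙ has finitely supported values. An extension to A is determined by the finitely
  -- supported image of 1, which forces p (n+1) to kill some y (p n).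
  let I : Ideal A :=
    { carrier := {r | ∃ n, r * (p n).1 = r}
      add_mem' := by
        rintro a b ⟨m, hm⟩ ⟨n, hn⟩
        refine ⟨max m n, ?_⟩
        rw [add_mul]
        congr 1
        · conv_lhs => rw [← hm, mul_assoc, hmono _ _ (le_max_left m n), hm]
        · conv_lhs => rw [← hn, mul_assoc, hmono _ _ (le_max_right m n), hn]
      zero_mem' := ⟨0, zero_mul _⟩
      smul_mem' := by
        rintro c a ⟨n, hn⟩
        exact ⟨n, by rw [smul_eq_mul, mul_assoc, hn]⟩ }
  have hzero : ∀ r ∈ I, ∃ m, ∀ n, m ≤ n → r • y (p n) = 0 := by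
    rintro r ⟨m, hm⟩
    refine ⟨m, fun n hmn => ?_⟩
    rw [← hm, mul_smul, ← hmono m n hmn, mul_smul, hy, smul_zero, smul_zero]
  have hfin : ∀ r : I, (Function.support fun n => r.1 • y (p n)).Finite := by
    intro r
    obtain ⟨m, hm⟩ := hzero r.1 r.2
    refine (Set.finite_lt_nat m).subset fun n hn => ?_
    by_contra hmn
    exact hn (hm n (not_lt.mp hmn))
  let f : I →ₗ[A] (ℕ →₀ E) :=
    { toFun := fun r => Finsupp.ofSupportFinite _ (hfin r)
      map_add' := fun a b => Finsupp.ext fun n => add_smul a.1 b.1 (y (p n))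
      map_smul' := fun c a => Finsupp.ext fun n => mul_smul c a.1 (y (p n)) }
  have hf : ∀ r n, f r n = r.1 • y (p n) := fun r n => rfl
  obtain ⟨g, hg⟩ := hE.out I.subtype I.injective_subtype f
  obtain ⟨n, hn⟩ : ∃ n, g 1 n = 0 := by
    obtain ⟨n, hn⟩ := Infinite.exists_notMem_finset (g 1).support
    exact ⟨n, Finsupp.notMem_support_iff.mp hn⟩
  have hmem : (p (n + 1)).1 ∈ I := ⟨n + 1, (p (n + 1)).2.2⟩
  refine hy' (p n) ?_
  have h1 := DFunLike.congr_fun (hg ⟨_, hmem⟩) n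
  rw [hf, Submodule.subtype_apply, ← mul_one (p (n + 1)).1, ← smul_eq_mul, map_smul,
    Finsupp.smul_apply, hn, smul_zero] at h1
  simpa [hpsucc] using h1.symm

/-! ### Each condition forces the V-ring property -/

section Descent

variable {A : Type u} [Ring A]

theorem isVModule_self_of_injective_decomposition (hA : IsVNRegularRing A)
    (H : ∀ (M : Type u) [AddCommGroup M] [Module A M], ∃ P Q : Submodule A M,
      IsCompl P Q ∧ Module.Injective A P ∧ IsVModule A Q) : IsVModule A A := by
  by_contra hV
  obtain ⟨L, x, s, h⟩ := exists_isCyclicMonolith hV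
  obtain ⟨P, Q, hPQ, hP, hQ⟩ := H (ℕ →₀ (A ⧸ L))
  obtain rfl := h.eq_bot_of_disjoint_jacobson (hQ.disjoint_jacobson hPQ)
  obtain rfl : P = ⊤ := eq_top_of_isCompl_bot hPQ
  have hinj : Module.Injective A (ℕ →₀ (A ⧸ L)) :=
    ((Module.Baer.of_injective hP).of_equiv Submodule.topEquiv).injective
  obtain ⟨g, hgJ, hg⟩ := exists_idempotent_generator_mod_annihilator hA hinj
    ((A ∙ s).comap (LinearMap.toSpanSingleton A (A ⧸ L) x))
  -- The map x ↦ gx is thus the identity on As and has image in As.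
  have key : ∀ r : A, r • x ∈ A ∙ s → r • g • x = r • x := fun r hr => (hg r hr x).symm
  obtain ⟨G, hG⟩ := h.exists_linearMap (z := g • x) fun r hr => by
    rw [key r (hr ▸ zero_mem _), hr]
  refine h.not_retract G (fun y => ?_) ?_
  · obtain ⟨r, rfl⟩ := h.generates y
    rw [hG]
    exact Submodule.smul_mem _ r hgJ
  · obtain ⟨r, hr⟩ := h.generates s
    have := key r (by rw [hr]; exact Submodule.mem_span_singleton_self s)
    rwa [← hG, hr] at this

theorem isVModule_self_of_projective_decomposition (hA : IsVNRegularRing A)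
    (H : ∀ (M : Type u) [AddCommGroup M] [Module A M], ∃ P Q : Submodule A M,
      IsCompl P Q ∧ Module.Projective A P ∧ IsVModule A Q) : IsVModule A A := by
  by_contra hV
  obtain ⟨L, x, s, h⟩ := exists_isCyclicMonolith hV
  obtain ⟨P, Q, hPQ, hP, hQ⟩ := H (A ⧸ L)
  obtain rfl : Q = ⊥ := by
    by_contra hQ0
    exact h.ne_zero
      (Submodule.disjoint_def.mp (hQ.disjoint_jacobson hPQ) s (h.mem Q hQ0) h.mem_jacobson)
  obtain rfl : P = ⊤ := eq_top_of_isCompl_bot hPQ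
  have hproj : Module.Projective A (A ⧸ L) := Module.Projective.of_equiv Submodule.topEquiv
  obtain ⟨i, hi⟩ := Module.projective_lifting_property L.mkQ LinearMap.id L.mkQ_surjective
  have hinj : Function.Injective i :=
    Function.LeftInverse.injective (g := L.mkQ) fun y => DFunLike.congr_fun hi y
  -- E embeds in A by i, and y ↦ i(y)bs fixes s because i(s)bi(s) = i(s).
  obtain ⟨b, hb⟩ := hA (i s)
  refine h.not_retract (LinearMap.toSpanSingleton A _ (b • s) ∘ₗ i) (fun y => ?_) (hinj ?_)
  · exact Submodule.smul_mem _ _ (Submodule.smul_mem _ _ (Submodule.mem_span_singleton_self s))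
  · simpa [mul_assoc] using hb

theorem isVModule_self_of_almostInjective (hA : IsVNRegularRing A)
    (H : ∀ (S : Type u) [AddCommGroup S] [Module A S],
      IsSimpleModule A S → IsAlmostInjective A S) : IsVModule A A := by
  by_contra hV
  obtain ⟨L, x, s, h⟩ := exists_isCyclicMonolith hV
  have hsimple := h.isSimpleModule_span
  let ρ := LinearMap.toSpanSingleton A (A ⧸ L) x
  let J : Submodule A A := (A ∙ s).comap ρ
  let f : J →ₗ[A] (A ∙ s) := ρ.restrict fun r hr => hr
  have hf : ∀ r (hr : r ∈ J), (f ⟨r, hr⟩ : A ⧸ L) = r • x := fun r hr => rfl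
  have hJ : ∀ r, r • x ∈ A ∙ s → r ∈ J := fun r hr => hr
  obtain ⟨a, ha⟩ := h.generates s
  have haJ : a ∈ J := hJ a (by rw [ha]; exact Submodule.mem_span_singleton_self s)
  let s' : A ∙ s := ⟨s, Submodule.mem_span_singleton_self s⟩
  have hfa : f ⟨a, haJ⟩ = s' := Subtype.ext ha
  -- It suffices to extend the multiplication by `x` on `J` to a map with values in `A ∙ s`.
  have main : ∀ z ∈ A ∙ s, (∀ r ∈ J, r • z = r • x) → False := by
    intro z hz hzJ
    obtain ⟨G, hG⟩ := h.exists_linearMap (z := z) fun r hr => by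
      rw [hzJ r (hJ r (hr ▸ zero_mem _)), hr]
    refine h.not_retract G (fun y => ?_) ?_
    · obtain ⟨r, rfl⟩ := h.generates y
      rw [hG]
      exact Submodule.smul_mem _ r hz
    · have := hzJ a haJ
      rwa [← hG, ha] at this
  obtain ⟨g, hg⟩ | ⟨π, hπ0, hπ, k, hk⟩ := H (A ∙ s) hsimple A J f
  · refine main (g 1) (g 1).2 fun r hr => ?_
    rw [← hf r hr, ← hg, LinearMap.comp_apply, Submodule.subtype_apply, ← Submodule.coe_smul,
      ← map_smul, smul_eq_mul, mul_one]
  · have hπr : ∀ r, π r = r * π 1 := fun r => by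
      conv_lhs => rw [← mul_one r, ← smul_eq_mul, map_smul, smul_eq_mul]
    have hkr : ∀ r (hr : r ∈ J), (k (f ⟨r, hr⟩) : A) = r * π 1 := fun r hr => by
      rw [← hπr]
      exact DFunLike.congr_fun hk ⟨r, hr⟩
    have hee : π 1 * π 1 = π 1 := by
      rw [← hπr]
      exact DFunLike.congr_fun hπ.eq 1
    obtain hkinj | hk0 := k.injective_or_eq_zero
    · obtain ⟨b, hb⟩ := hA (k s')
      have hcbs : ((k s' : A) * b) • s' = s' := hkinj (Subtype.ext (by simpa using hb))
      have hcbs' : ((k s' : A) * b) • s = s := congrArg Subtype.val hcbs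
      -- With c = k(s) and e = π(1): if rx = ds then re = dc, so rebs = dcbs = ds.
      refine main ((π 1 * b) • s)
        (Submodule.smul_mem _ _ (Submodule.mem_span_singleton_self s)) fun r hr => ?_
      obtain ⟨d, hd⟩ := Submodule.mem_span_singleton.mp (show r • x ∈ A ∙ s from hr)
      have hfr : f ⟨r, hr⟩ = d • s' := Subtype.ext hd.symm
      have hre : r * π 1 = d * (k s' : A) := by
        rw [← hkr r hr, hfr, map_smul]
        rfl
      rw [← mul_smul, ← mul_assoc, hre, mul_assoc, mul_smul, hcbs', hd]
    · have hzero : ∀ r ∈ J, r * π 1 = 0 := fun r hr => by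
        rw [← hkr r hr, hk0]
        rfl
      -- Here Je = 0 for e = π(1). If ex = 0 then e ∈ J and e = ee = 0; otherwise bex = s for some
      -- b, so be ∈ J and be = bee = 0.
      have hex : π 1 • x ≠ 0 := fun h0 => hπ0 (LinearMap.ext fun r => by
        rw [hπr, ← hee, hzero _ (hJ _ (h0 ▸ zero_mem _)), mul_zero, LinearMap.zero_apply])
      obtain ⟨b, hb⟩ := h.exists_smul_eq hex
      rw [← mul_smul] at hb
      have hbe := hzero (b * π 1) (hJ _ (by
        rw [hb]
        exact Submodule.mem_span_singleton_self s))
      rw [mul_assoc, hee] at hbe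
      exact h.ne_zero (by rw [← hb, hbe, zero_smul])

end Descent

/-! ### Consequences of the V-ring property -/

section Ascent

variable {A : Type u} [Ring A]

theorem IsVModule.injective_of_isSimpleModule (hA : IsVModule A A) (S : Type u) [AddCommGroup S]
    [Module A S] [IsSimpleModule A S] : Module.Injective A S := by
  refine Module.Baer.injective fun I f => ?_
  obtain hf | ⟨⟨i, hiI⟩, hi⟩ : f = 0 ∨ ∃ i, f i ≠ 0 := by
    by_contra! hcon
    exact hcon.1 (LinearMap.ext hcon.2)
  · exact ⟨0, by simp [hf]⟩
  obtain ⟨K, hK, hfK, hiK⟩ := isVModule_iff_exists_isCoatom.mp hA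
    ((LinearMap.ker f).map I.subtype) i (by
      rintro ⟨j, hj, rfl⟩
      exact hi hj)
  -- Simplicity gives K ∩ I = ker f. Writing 1 = l + ai with l ∈ K, the map r ↦ raf(i) extends f,
  -- since r - rai = rl lies in K.
  have hker : ∀ r (hr : r ∈ I), r ∈ K → f ⟨r, hr⟩ = 0 := by
    intro r hr hrK
    by_contra hfr
    obtain ⟨d, hd⟩ := IsSimpleModule.toSpanSingleton_surjective A hfr (f ⟨i, hiI⟩)
    have hmem : i - d * r ∈ K := hfK ⟨⟨i, hiI⟩ - d • ⟨r, hr⟩, by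
      simp only [SetLike.mem_coe, LinearMap.mem_ker, map_sub, map_smul]
      rw [← hd, LinearMap.toSpanSingleton_apply, sub_self], rfl⟩
    exact hiK (by simpa using K.add_mem hmem (K.smul_mem d hrK))
  have htop : (1 : A) ∈ K ⊔ (A ∙ i) := by
    rw [hK.2 (K ⊔ (A ∙ i)) (left_lt_sup.mpr fun hle =>
      hiK (hle (Submodule.mem_span_singleton_self i)))]
    trivial
  obtain ⟨l, hl, _, hai, hsum⟩ := Submodule.mem_sup.mp htop
  obtain ⟨a, rfl⟩ := Submodule.mem_span_singleton.mp hai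
  refine ⟨LinearMap.toSpanSingleton A S (a • f ⟨i, hiI⟩), fun r hr => ?_⟩
  have hrl : r - (r * a) * i = r * l := by
    rw [smul_eq_mul] at hsum
    rw [mul_assoc, sub_eq_iff_eq_add, ← mul_add, hsum, mul_one]
  have h0 := hker (r - (r * a) * i) (I.sub_mem hr (I.mul_mem_left _ hiI))
    (hrl ▸ K.smul_mem r hl)
  have h1 : f ⟨r, hr⟩ - (r * a) • f ⟨i, hiI⟩ = 0 := by
    rw [← map_smul, ← map_sub]
    exact h0
  rw [LinearMap.toSpanSingleton_apply, ← mul_smul]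
  exact (sub_eq_zero.mp h1).symm

theorem isVModule_of_isVModule_self (hA : IsVModule A A) (M : Type u) [AddCommGroup M]
    [Module A M] : IsVModule A M := by
  rw [isVModule_iff_exists_isCoatom]
  intro N y hy
  obtain ⟨L, hNL, hyL, hL⟩ := Submodule.exists_le_maximal_notMem hy
  refine ⟨L, ?_, hNL, hyL⟩
  have hmem : ∀ T : Submodule A (M ⧸ L), T ≠ ⊥ → L.mkQ y ∈ T := by
    intro T hT
    refine hL (T.comap L.mkQ) (lt_of_le_of_ne (Submodule.le_comap_mkQ L T) fun hLT => hT ?_)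
    rw [← Submodule.map_comap_eq_of_surjective L.mkQ_surjective T, ← hLT, Submodule.mkQ_map_self]
  have hne : L.mkQ y ≠ 0 := by simpa using hyL
  have hsimple : IsSimpleModule A (A ∙ L.mkQ y) := by
    rw [isSimpleModule_iff_isAtom]
    refine ⟨by simpa using hne, fun T hT => by_contra fun hT0 => ?_⟩
    exact hT.not_ge ((Submodule.span_singleton_le_iff_mem _ _).mpr (hmem T hT0))
  -- The least nonzero submodule of M/L is simple, hence injective; the retraction onto it has zero
  -- kernel, so M/L is itself simple.
  obtain ⟨g, hg⟩ := (hA.injective_of_isSimpleModule (A ∙ L.mkQ y)).out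
    (A ∙ L.mkQ y).subtype (Submodule.injective_subtype _) LinearMap.id
  have hinj : Function.Injective g := by
    rw [← LinearMap.ker_eq_bot]
    by_contra hk
    have h0 : g (L.mkQ y) = 0 := hmem _ hk
    have h1 := hg ⟨L.mkQ y, Submodule.mem_span_singleton_self _⟩
    rw [Submodule.subtype_apply, h0] at h1
    exact hne (congrArg Subtype.val h1.symm)
  have hsurj : Function.Surjective g := fun z => ⟨z, hg z⟩
  exact isSimpleModule_iff_isCoatom.mp
    (IsSimpleModule.congr (LinearEquiv.ofBijective g ⟨hinj, hsurj⟩))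

end Ascent

/-- A ring and its opposite agree as right modules. -/
def rightRegularEquivMulOpposite (R : Type u) [Ring R] : R ≃ₗ[Rᵐᵒᵖ] Rᵐᵒᵖ where
  toFun := MulOpposite.op
  invFun := MulOpposite.unop
  left_inv _ := rfl
  right_inv _ := rfl
  map_add' _ _ := rfl
  map_smul' _ _ := rfl

theorem isRightVRing_iff (R : Type u) [Ring R] : IsRightVRing R ↔ IsVModule Rᵐᵒᵖ Rᵐᵒᵖ :=
  ⟨IsVModule.of_linearEquiv (rightRegularEquivMulOpposite R),
    IsVModule.of_linearEquiv (rightRegularEquivMulOpposite R).symm⟩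

theorem theorem2p3 (R : Type u) [Ring R] (hR : IsVNRegularRing R) :
    List.TFAE [
      IsRightVRing R,
      ∀ (M : Type u) [AddCommGroup M] [Module Rᵐᵒᵖ M],
        ∃ P Q : Submodule Rᵐᵒᵖ M,
          IsCompl P Q ∧ Module.Injective Rᵐᵒᵖ P ∧ IsVModule Rᵐᵒᵖ Q,
      ∀ (M : Type u) [AddCommGroup M] [Module Rᵐᵒᵖ M],
        ∃ P Q : Submodule Rᵐᵒᵖ M,
          IsCompl P Q ∧ Module.Projective Rᵐᵒᵖ P ∧ IsVModule Rᵐᵒᵖ Q,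
      IsRightAlmostVRing R] := by
  have hA := hR.mulOpposite
  tfae_have 1 → 2 := fun h M _ _ => ⟨⊥, ⊤, isCompl_bot_top,
    ⟨fun _ _ _ _ _ _ _ _ _ => ⟨0, fun _ => Subsingleton.elim _ _⟩⟩,
    isVModule_of_isVModule_self ((isRightVRing_iff R).mp h) _⟩
  tfae_have 1 → 3 := fun h M _ _ => ⟨⊥, ⊤, isCompl_bot_top, inferInstance,
    isVModule_of_isVModule_self ((isRightVRing_iff R).mp h) _⟩
  tfae_have 1 → 4 := by
    intro h S _ _ hS N _ _ N' f
    have hinj := ((isRightVRing_iff R).mp h).injective_of_isSimpleModule S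
    obtain ⟨g, hg⟩ := hinj.out N'.subtype N'.injective_subtype f
    exact Or.inl ⟨g, LinearMap.ext hg⟩
  tfae_have 2 → 1 := fun h =>
    (isRightVRing_iff R).mpr (isVModule_self_of_injective_decomposition hA h)
  tfae_have 3 → 1 := fun h =>
    (isRightVRing_iff R).mpr (isVModule_self_of_projective_decomposition hA h)
  tfae_have 4 → 1 := fun h =>
    (isRightVRing_iff R).mpr (isVModule_self_of_almostInjective hA h)
  tfae_finish
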